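/- Let $V=\bigoplus_{n\in\mathbb Z}V_n$ be a vertex operator algebra over $\mathbb C$ (with $\dim V_n<\infty$ and $V_n=0$ for $n$ sufficiently negative), with vertex operators $Y(v,z)=\sum_{n\in\mathbb Z}v_nz^{-n-1}$, vacuum $\mathbf 1$ and conformal vector $\omega$; write $L(n)=\omega_{n+1}$. Suppose that $V$ is of CFT type, that is, $V$ is simple, $V=\bigoplus_{n\ge 0}V_n$ and $\dim V_0=1$. A weak $V$-module is a complex vector space $M$ with a linear map $v\mapsto Y_M(v,z)=\sum_{n\in\mathbb Z}v_nz^{-n-1}$, $v_n\in\operatorname{End}M$, such that for all $v\in V$, $w\in M$ one has $v_nw=0$ for $n$ sufficiently large, $Y_M(\mathbf 1,z)=\mathrm{id}_M$, and the Jacobi identity holds. It is admissible if it carries a grading $M=\bigoplus_{n\ge 0}M(n)$ with $a_mM(n)\subseteq M(r+n-m-1)$ for all $a\in V_r$, $r,m\in\mathbb Z$, $n\ge 0$, where $M(k)=0$ for $k<0$. For a weak $V$-module $M$ let $o\colon V\to\operatorname{End}M$ be the linear map with $o(v)=v_{n-1}$ for $v\in V_n$, and let $$J_M(V)=\{v\in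 V : o(v)=0\text{ on }M\},\qquad J_M(V)_{(0,1)}=(V_0+V_1)\cap J_M(V).$$ In particular $J_V(V)$ is defined by regarding $V$ as a module over itself. Then for every nonzero admissible $V$-module $M$, $$J_M(V)=(L(0)+L(-1))V+J_M(V)_{(0,1)}.$$ Moreover, if $a=a^0+a^1\in J_M(V)_{(0,1)}$ with $a^i\in V_i$, then $a^1\in J_V(V)$; that is, the image of the projection of $J_M(V)_{(0,1)}$ into $V_1$ is contained in $J_V(V)$. -/

import Mathlib

noncomputable section

universe u v

/-- For a linear map `v ↦ Y(v, z) = ∑ₙ vₙ z^{-n-1}` from `V` to the vertex operators on `M`,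
`mode Y v n` is the endomorphism `vₙ` of `M`.  For `v` and `w` fixed, `vₙ w = 0` for all
sufficiently large `n`, because `Y(v, z) w` is a Laurent series. -/
def mode {V : Type u} {M : Type v} [AddCommGroup V] [Module ℂ V] [AddCommGroup M] [Module ℂ M]
    (Y : V →ₗ[ℂ] VertexOperator ℂ M) (v : V) (n : ℤ) : Module.End ℂ M :=
  VertexOperator.ncoeff (Y v) n

/-- The Jacobi identity
`z₀⁻¹ δ((z₁ - z₂)/z₀) Y_M(u, z₁) Y_M(v, z₂) - z₀⁻¹ δ((z₂ - z₁)/(-z₀)) Y_M(v, z₂) Y_M(u, z₁)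
  = z₂⁻¹ δ((z₁ - z₀)/z₂) Y_M(Y(u, z₀) v, z₂)`,
written as the equality of the coefficients of `z₀^{-r-1} z₁^{-p-1} z₂^{-q-1}` on both sides,
applied to `w` in `M`.  Only finitely many terms of each sum are nonzero. -/
def JacobiIdentity {V : Type u} {M : Type v} [AddCommGroup V] [Module ℂ V]
    [AddCommGroup M] [Module ℂ M]
    (Y : V →ₗ[ℂ] VertexOperator ℂ V) (YM : V →ₗ[ℂ] VertexOperator ℂ M) : Prop :=
  ∀ (u v : V) (w : M) (p q r : ℤ),
    (∑ᶠ i : ℕ, ((-1) ^ i * Ring.choose r i : ℤ) •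
      (mode YM u (p + r - i) (mode YM v (q + i) w)
        - (r.negOnePow : ℤ) • mode YM v (q + r - i) (mode YM u (p + i) w)))
    = ∑ᶠ i : ℕ, (Ring.choose p i : ℤ) • mode YM (mode Y u (r + i) v) (p + q - i) w

/-- The structure `(Y, 𝟏, ω)` of a vertex operator algebra on a complex vector space `V`, with
its weight grading `V = ⨁ₙ Vₙ`, `n ∈ ℤ`.  The Virasoro operators are `L(n) = ω_{n+1}`. -/
structure VertexOperatorAlgebra (V : Type u) [AddCommGroup V] [Module ℂ V] where
  /-- the vertex operators `Y(v, z)` -/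
  Y : V →ₗ[ℂ] VertexOperator ℂ V
  /-- the vacuum vector `𝟏` -/
  vacuum : V
  /-- the conformal vector `ω` -/
  conformal : V
  /-- the central charge -/
  centralCharge : ℂ
  /-- the weight space `Vₙ` -/
  grade : ℤ → Submodule ℂ V
  grade_isInternal : DirectSum.IsInternal grade
  grade_finite : ∀ n, FiniteDimensional ℂ (grade n)
  grade_bounded_below : ∃ N : ℤ, ∀ n < N, grade n = ⊥
  vacuum_mem : vacuum ∈ grade 0
  conformal_mem : conformal ∈ grade 2
  vacuum_mode : ∀ n : ℤ, mode Y vacuum n = if n = -1 then 1 else 0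
  creation : ∀ v : V, mode Y v (-1) vacuum = v
  creation_regular : ∀ (v : V) (n : ℤ), 0 ≤ n → mode Y v n vacuum = 0
  jacobi : JacobiIdentity Y Y
  virasoro : ∀ m n : ℤ,
    mode Y conformal (m + 1) * mode Y conformal (n + 1)
        - mode Y conformal (n + 1) * mode Y conformal (m + 1)
      = ((m : ℂ) - n) • mode Y conformal (m + n + 1)
        + (if m + n = 0 then ((m : ℂ) ^ 3 - m) / 12 * centralCharge else 0) • 1
  L_zero_eq : ∀ (n : ℤ), ∀ v ∈ grade n, mode Y conformal 1 v = (n : ℂ) • v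
  L_neg_one_derivative : ∀ (v : V) (n : ℤ),
    mode Y (mode Y conformal 0 v) n = (-(n : ℂ)) • mode Y v (n - 1)

namespace VertexOperatorAlgebra

variable {V : Type u} [AddCommGroup V] [Module ℂ V]

/-- The Virasoro operator `L(n) = ω_{n+1}` on `V`. -/
def L (𝒱 : VertexOperatorAlgebra V) (n : ℤ) : Module.End ℂ V :=
  mode 𝒱.Y 𝒱.conformal (n + 1)

/-- The isomorphism `⨁ₙ Vₙ ≃ V`. -/
def gradeEquiv (𝒱 : VertexOperatorAlgebra V) :
    (DirectSum ℤ fun n => 𝒱.grade n) ≃ₗ[ℂ] V :=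
  LinearEquiv.ofBijective (DirectSum.coeLinearMap 𝒱.grade) 𝒱.grade_isInternal

/-- `V` is simple: it is nonzero, and its only subspaces stable under all `aₙ`, `a ∈ V`, `n ∈ ℤ`,
are `0` and `V`. -/
def IsSimple (𝒱 : VertexOperatorAlgebra V) : Prop :=
  Nontrivial V ∧
    ∀ I : Submodule ℂ V, (∀ (a : V) (n : ℤ), ∀ w ∈ I, mode 𝒱.Y a n w ∈ I) → I = ⊥ ∨ I = ⊤

/-- `V` is of CFT type: it is simple, `V = ⨁_{n ≥ 0} Vₙ`, and `V₀` is one-dimensional. -/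
def IsCFTType (𝒱 : VertexOperatorAlgebra V) : Prop :=
  𝒱.IsSimple ∧ (∀ n < 0, 𝒱.grade n = ⊥) ∧ Module.finrank ℂ (𝒱.grade 0) = 1

end VertexOperatorAlgebra

/-- The structure `Y_M` of a weak module on a complex vector space `M` over a vertex operator
algebra. -/
structure WeakModule {V : Type u} [AddCommGroup V] [Module ℂ V] (𝒱 : VertexOperatorAlgebra V)
    (M : Type v) [AddCommGroup M] [Module ℂ M] where
  /-- the vertex operators `Y_M(v, z)` -/
  Y : V →ₗ[ℂ] VertexOperator ℂ M
  vacuum_mode : ∀ n : ℤ, mode Y 𝒱.vacuum n = if n = -1 then 1 else 0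
  jacobi : JacobiIdentity 𝒱.Y Y

/-- The structure of an admissible module on `M`: a weak module with a grading
`M = ⨁_{n ≥ 0} M(n)` such that `aₘ M(n) ⊆ M(r + n - m - 1)` for `a ∈ Vᵣ`, where `M(k) = 0`
for `k < 0`. -/
structure AdmissibleModule {V : Type u} [AddCommGroup V] [Module ℂ V]
    (𝒱 : VertexOperatorAlgebra V) (M : Type v) [AddCommGroup M] [Module ℂ M]
    extends WeakModule 𝒱 M where
  /-- the homogeneous subspace `M(n)` -/
  grade : ℕ → Submodule ℂ M
  grade_isInternal : DirectSum.IsInternal grade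
  mode_mem : ∀ (r m : ℤ) (n k : ℕ), (k : ℤ) = r + n - m - 1 →
    ∀ a ∈ 𝒱.grade r, ∀ w ∈ grade n, mode Y a m w ∈ grade k
  mode_eq_zero : ∀ (r m : ℤ) (n : ℕ), r + n - m - 1 < 0 →
    ∀ a ∈ 𝒱.grade r, ∀ w ∈ grade n, mode Y a m w = 0

/-- `V` as a module over itself. -/
def VertexOperatorAlgebra.adjoint {V : Type u} [AddCommGroup V] [Module ℂ V]
    (𝒱 : VertexOperatorAlgebra V) : WeakModule 𝒱 V where
  Y := 𝒱.Y
  vacuum_mode := 𝒱.vacuum_mode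
  jacobi := 𝒱.jacobi

namespace WeakModule

variable {V : Type u} [AddCommGroup V] [Module ℂ V] {𝒱 : VertexOperatorAlgebra V}
  {M : Type v} [AddCommGroup M] [Module ℂ M]

/-- The linear map `v ↦ vₙ` from `V` to `End M`, for `n` fixed. -/
def modeLinear (W : WeakModule 𝒱 M) (n : ℤ) : V →ₗ[ℂ] Module.End ℂ M :=
  LinearMap.proj n ∘ₗ VertexOperator.ncoeff ∘ₗ W.Y

/-- The linear map `v ↦ o(v)` from `V` to `End M` with `o(v) = v_{n-1}` for `v ∈ Vₙ`. -/
def zeroMode (W : WeakModule 𝒱 M) : V →ₗ[ℂ] Module.End ℂ M :=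
  DirectSum.toModule ℂ ℤ (Module.End ℂ M)
      (fun n => W.modeLinear (n - 1) ∘ₗ (𝒱.grade n).subtype) ∘ₗ
    𝒱.gradeEquiv.symm.toLinearMap

theorem zeroMode_of_mem (W : WeakModule 𝒱 M) {n : ℤ} {v : V} (hv : v ∈ 𝒱.grade n) :
    W.zeroMode v = mode W.Y v (n - 1) := by
  have h : 𝒱.gradeEquiv.symm v = DirectSum.lof ℂ ℤ (fun i => 𝒱.grade i) n ⟨v, hv⟩ := by
    rw [LinearEquiv.symm_apply_eq]
    exact (DirectSum.coeLinearMap_lof 𝒱.grade n ⟨v, hv⟩).symm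
  simp only [zeroMode, LinearMap.comp_apply, LinearEquiv.coe_coe, h, DirectSum.toModule_lof]
  rfl

/-- The `M`-radical `J_M(V) = {v ∈ V | o(v) = 0 on M}`. -/
def radical (W : WeakModule 𝒱 M) : Submodule ℂ V :=
  LinearMap.ker W.zeroMode

/-- `J_M(V)_{(0,1)} = (V₀ + V₁) ∩ J_M(V)`. -/
def radical01 (W : WeakModule 𝒱 M) : Submodule ℂ V :=
  (𝒱.grade 0 ⊔ 𝒱.grade 1) ⊓ W.radical

end WeakModule

end

noncomputable section

section Mode

variable {V M : Type*} [AddCommGroup V] [Module ℂ V] [AddCommGroup M] [Module ℂ M]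
  (Y : V →ₗ[ℂ] VertexOperator ℂ M)

/-! Put `T = (L(0) + L(-1))V`; it is killed by `o`. On positive weights, `T` identifies a vector
with a multiple of its `L(-1)`-image, so modulo `T` a radical vector becomes `c + w` with `c ∈ V₀ =
ℂ𝟏` and `w` of a single weight `N + 1`. Then `o(w) = w_N` is a scalar on `M`, so its commutators `∑ᵢ
(N choose i) (wᵢ a)_{m-i}` with modes of `a` vanish. Simplicity makes `V` act faithfully, and terms
of distinct weights separate (`eq_zero_of_sum_mode_eq_zero`), so `w₀, …, w_N` vanish on `V`. Skew
symmetry for `ω₁ w = (N + 1) w` then leaves only a multiple of `x_{-1-N} 𝟏` with `x = w_{N+1} ω ∈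
V₁`, which is a multiple of `x` modulo `T` (`exists_weight_one_sub_mem`). The second claim is the
vanishing statement for `N = 0`. -/

theorem mode_zero (n : ℤ) : mode Y 0 n = 0 := by
  simp [mode]

theorem mode_smul (c : ℂ) (a : V) (n : ℤ) : mode Y (c • a) n = c • mode Y a n := by
  simp [mode]

end Mode

/-! ### Consequences of the Jacobi identity -/

namespace WeakModule

variable {V M : Type*} [AddCommGroup V] [Module ℂ V] {𝒱 : VertexOperatorAlgebra V}
  [AddCommGroup M] [Module ℂ M] (W : WeakModule 𝒱 M)

/-- The commutator formula for a nonnegative mode of `a`. -/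
theorem mode_commutator (a b : V) (p : ℕ) (q : ℤ) (w : M) :
    mode W.Y a p (mode W.Y b q w) - mode W.Y b q (mode W.Y a p w)
      = ∑ i ∈ Finset.range (p + 1),
          (p.choose i : ℤ) • mode W.Y (mode 𝒱.Y a i b) (p + q - i) w := by
  have h := W.jacobi a b w p q 0
  rw [finsum_eq_single _ 0, finsum_eq_sum_of_support_subset (s := Finset.range (p + 1))] at h
  · simpa [Ring.choose_natCast] using h
  · intro i hi
    by_contra hne
    apply hi
    have : p < i := by simpa using hne
    simp [Ring.choose_natCast, Nat.choose_eq_zero_of_lt this]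
  · intro i hi
    simp [Ring.choose_zero_pos ℤ (Nat.pos_of_ne_zero hi)]

/-- The iterate formula for the modes of `aₙ b`. -/
theorem mode_mode_eq_finsum (a b : V) (n q : ℤ) (w : M) :
    mode W.Y (mode 𝒱.Y a n b) q w
      = ∑ᶠ i : ℕ, ((-1) ^ i * Ring.choose n i : ℤ) •
          (mode W.Y a (n - i) (mode W.Y b (q + i) w)
            - (n.negOnePow : ℤ) • mode W.Y b (q + n - i) (mode W.Y a i w)) := by
  have h := W.jacobi a b w 0 q n
  rw [finsum_eq_single (fun i : ℕ => (Ring.choose (0 : ℤ) i : ℤ) • _) 0] at h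
  · simpa using h.symm
  · intro i hi
    simp [Ring.choose_zero_pos ℤ (Nat.pos_of_ne_zero hi)]

/-- If all modes of `b` vanish on `M`, then so do all modes of `aₙ b`. -/
theorem mode_mode_eq_zero {b : V} (hb : ∀ q, mode W.Y b q = 0) (a : V) (n q : ℤ) :
    mode W.Y (mode 𝒱.Y a n b) q = 0 := by
  ext w
  simp [mode_mode_eq_finsum, hb]

/-- Lets the iterate formula carry the `L(-1)`-derivative property over to modules. -/
theorem conformal_zero_eq (v : V) :
    mode 𝒱.Y 𝒱.conformal 0 v = mode 𝒱.Y v (-2) 𝒱.vacuum := by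
  have h := congrArg (fun f => f 𝒱.vacuum) (𝒱.L_neg_one_derivative v (-1))
  simpa [𝒱.creation] using h

/-- The modes of `a₁ b` in terms of those of `a` and `b`. -/
theorem mode_mode_one (a b : V) (q : ℤ) (w : M) :
    mode W.Y (mode 𝒱.Y a 1 b) q w
      = mode W.Y a 1 (mode W.Y b q w) + mode W.Y b (q + 1) (mode W.Y a 0 w)
        - mode W.Y a 0 (mode W.Y b (q + 1) w) - mode W.Y b q (mode W.Y a 1 w) := by
  rw [mode_mode_eq_finsum, finsum_eq_sum_of_support_subset (s := Finset.range 2)]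
  · simp [Finset.sum_range_succ]
    abel
  · intro i hi
    by_contra hne
    apply hi
    have h : 1 < i := by simpa using hne
    have := Ring.choose_natCast (R := ℤ) 1 i
    simp only [Nat.cast_one, Nat.choose_eq_zero_of_lt h] at this
    simp [this]

/-- The `L(-1)`-derivative property holds on every weak module. -/
theorem mode_conformal_zero (v : V) (n : ℤ) :
    mode W.Y (mode 𝒱.Y 𝒱.conformal 0 v) n = (-(n : ℂ)) • mode W.Y v (n - 1) := by
  ext w
  have hc : ∀ i : ℕ, ((-1) ^ i * Ring.choose (-2 : ℤ) i : ℤ) = i + 1 := by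
    intro i
    have : Ring.choose (-2 : ℤ) i = (-1) ^ i * (i + 1) := by
      rw [Ring.choose_neg]
      have : (2 + (i : ℤ) - 1) = ((i + 1 : ℕ) : ℤ) := by push_cast; ring
      rw [this, Ring.choose_natCast]
      simp [Int.negOnePow, Units.smul_def]
      ring
    rw [this, ← mul_assoc, ← pow_add, ← two_mul]
    simp
  rw [conformal_zero_eq, mode_mode_eq_finsum]
  simp only [hc, Int.negOnePow_even (-2) (by decide), W.vacuum_mode]
  -- The vacuum mode selects one index: `i = -1 - n` in the first product if `n < 0`, `i = n - 1` in
  -- the second if `n > 0`, and none if `n = 0`.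
  rcases lt_or_ge n 0 with hn | hn
  · obtain ⟨k, rfl⟩ : ∃ k : ℕ, n = -1 - k := ⟨(-1 - n).toNat, by omega⟩
    rw [finsum_eq_single _ k]
    · rw [if_pos (by ring), if_neg (by omega), show (-2 - (k : ℤ)) = -1 - k - 1 by ring,
        ← Int.cast_smul_eq_zsmul ℂ]
      simp
    · intro i hi
      rw [if_neg (by omega), if_neg (by omega)]
      simp
  · by_cases h0 : n = 0
    · subst h0
      rw [finsum_eq_zero_of_forall_eq_zero]
      · simp
      · intro i
        rw [if_neg (by omega), if_neg (by omega)]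
        simp
    · obtain ⟨k, rfl⟩ : ∃ k : ℕ, n = 1 + k := ⟨(n - 1).toNat, by omega⟩
      rw [finsum_eq_single _ k]
      · rw [if_neg (by omega), if_pos (by ring), show (1 + (k : ℤ) - 1) = k by ring,
          ← Int.cast_smul_eq_zsmul ℂ]
        simp [add_comm]
        module
      · intro i hi
        rw [if_neg (by omega), if_neg (by omega)]
        simp

/-- `[L(0), aₘ] = (L(-1) a)ₘ₊₁ + (L(0) a)ₘ` for a homogeneous vector `a`. -/
theorem mode_conformal_one_mode {r : ℤ} {a : V} (ha : a ∈ 𝒱.grade r) (m : ℤ) (w : M) :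
    mode W.Y 𝒱.conformal 1 (mode W.Y a m w)
      = mode W.Y a m (mode W.Y 𝒱.conformal 1 w) + ((r : ℂ) - m - 1) • mode W.Y a m w := by
  have h := W.mode_commutator 𝒱.conformal a 1 m w
  simp only [Finset.sum_range_succ, Finset.sum_range_zero, Nat.cast_zero, Nat.cast_one,
    Nat.choose_self, Nat.choose_zero_right, W.mode_conformal_zero, 𝒱.L_zero_eq r a ha,
    mode_smul] at h
  rw [sub_eq_iff_eq_add] at h
  rw [h]
  simp only [one_smul, zero_add, LinearMap.smul_apply]
  rw [show 1 + m - 0 - 1 = m by ring, show 1 + m - 1 = m by ring]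
  push_cast
  module

end WeakModule

/-! ### The grading of `V` and reduction modulo `translationSpace` -/

namespace VertexOperatorAlgebra

variable {V : Type*} [AddCommGroup V] [Module ℂ V] (𝒱 : VertexOperatorAlgebra V)

/-- The weight spaces are the full eigenspaces of `L(0)`. -/
theorem mem_grade_of_eigenvector {n : ℤ} {v : V}
    (hv : mode 𝒱.Y 𝒱.conformal 1 v = (n : ℂ) • v) : v ∈ 𝒱.grade n := by
  set E : ℤ → Submodule ℂ V := fun k =>
    Module.End.eigenspace (mode 𝒱.Y 𝒱.conformal 1) (k : ℂ)
  have hle : ∀ k, 𝒱.grade k ≤ E k := fun k x hx =>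
    Module.End.mem_eigenspace_iff.mpr (𝒱.L_zero_eq k x hx)
  have hind : iSupIndep E :=
    (Module.End.eigenspaces_iSupIndep (mode 𝒱.Y 𝒱.conformal 1)).comp Int.cast_injective
  have htop : 𝒱.grade n ⊔ ⨆ j ≠ n, 𝒱.grade j = ⊤ := by
    rw [eq_top_iff, ← 𝒱.grade_isInternal.submodule_iSup_eq_top]
    refine iSup_le fun j => ?_
    by_cases hj : j = n
    · exact hj ▸ le_sup_left
    · exact le_sup_of_le_right (le_iSup₂_of_le j hj le_rfl)
  obtain ⟨x, hx, y, hy, rfl⟩ := Submodule.mem_sup.mp (htop ▸ Submodule.mem_top (x := v))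
  have hyE : y ∈ ⨆ j ≠ n, E j := (iSup₂_mono fun j _ => hle j) hy
  have hyn : y ∈ E n := by
    have : x + y ∈ E n := Module.End.mem_eigenspace_iff.mpr hv
    simpa using (E n).sub_mem this (hle n hx)
  have : y = 0 := Submodule.disjoint_def.mp (hind n) y hyn hyE
  simpa [this] using hx

/-- `aₘ Vₙ ⊆ V_{r+n-m-1}` for `a ∈ Vᵣ`. -/
theorem mode_mem_grade {r m n k : ℤ} {a w : V} (ha : a ∈ 𝒱.grade r) (hw : w ∈ 𝒱.grade n)
    (hk : k = r + n - m - 1) : mode 𝒱.Y a m w ∈ 𝒱.grade k := by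
  apply 𝒱.mem_grade_of_eigenvector
  have h := 𝒱.adjoint.mode_conformal_one_mode ha m w
  simp only [adjoint] at h
  rw [h, 𝒱.L_zero_eq n w hw, map_smul, ← add_smul]
  subst hk
  push_cast
  congr 1
  ring

theorem conformal_zero_mem_grade {n : ℤ} {v : V} (hv : v ∈ 𝒱.grade n) :
    mode 𝒱.Y 𝒱.conformal 0 v ∈ 𝒱.grade (n + 1) :=
  𝒱.mode_mem_grade 𝒱.conformal_mem hv (by ring)

@[elab_as_elim]
theorem induction_grade {p : V → Prop} (v : V) (hom : ∀ n, ∀ x ∈ 𝒱.grade n, p x)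
    (add : ∀ x y, p x → p y → p (x + y)) : p v :=
  Submodule.iSup_induction 𝒱.grade (motive := p)
    (𝒱.grade_isInternal.submodule_iSup_eq_top ▸ Submodule.mem_top) hom
    (hom 0 0 (zero_mem _)) add

/-- The space `(L(0) + L(-1)) V`. -/
def translationSpace : Submodule ℂ V := LinearMap.range (𝒱.L 0 + 𝒱.L (-1))

theorem smul_add_conformal_zero_mem {n : ℤ} {v : V} (hv : v ∈ 𝒱.grade n) :
    (n : ℂ) • v + mode 𝒱.Y 𝒱.conformal 0 v ∈ 𝒱.translationSpace :=
  ⟨v, by simp [L, 𝒱.L_zero_eq n v hv]⟩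

/-- `L(-1) xₙ 𝟏 = -n xₙ₋₁ 𝟏`. -/
theorem conformal_zero_mode_vacuum (x : V) (n : ℤ) :
    mode 𝒱.Y 𝒱.conformal 0 (mode 𝒱.Y x n 𝒱.vacuum)
      = (-(n : ℂ)) • mode 𝒱.Y x (n - 1) 𝒱.vacuum := by
  have h := 𝒱.adjoint.mode_commutator 𝒱.conformal x 0 n 𝒱.vacuum
  simpa [adjoint, 𝒱.creation_regular, 𝒱.L_neg_one_derivative] using h

/-- Modulo `(L(0) + L(-1)) V`, the vector `x₋₁₋ᵢ 𝟏` is a multiple of `x`, for `x` of weight `1`. -/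
theorem mode_vacuum_sub_mem {x : V} (hx : x ∈ 𝒱.grade 1) (i : ℕ) :
    mode 𝒱.Y x (-1 - i) 𝒱.vacuum - (-1 : ℂ) ^ i • x ∈ 𝒱.translationSpace := by
  induction i with
  | zero => simp [𝒱.creation]
  | succ i ih =>
    have hz : mode 𝒱.Y x (-1 - i) 𝒱.vacuum ∈ 𝒱.grade (i + 1) :=
      𝒱.mode_mem_grade hx 𝒱.vacuum_mem (by ring)
    -- On `x_{-1-i} 𝟏`, `L(0) + L(-1)` gives `(i + 1)(x_{-1-i} 𝟏 + x_{-2-i} 𝟏)`, so each shift flips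
    -- the sign.
    have h := 𝒱.smul_add_conformal_zero_mem hz
    rw [conformal_zero_mode_vacuum] at h
    have hi : ((i : ℂ) + 1) ≠ 0 := Nat.cast_add_one_ne_zero i
    have h' := (𝒱.translationSpace).sub_mem
      ((𝒱.translationSpace).smul_mem ((i : ℂ) + 1)⁻¹ h) ih
    convert h' using 1
    rw [show (-1 - ((i + 1 : ℕ) : ℤ)) = -1 - i - 1 by push_cast; ring]
    push_cast
    rw [show (-(-1 - (i : ℂ))) = i + 1 by ring, ← smul_add, smul_smul, inv_mul_cancel₀ hi,
      pow_succ]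
    module

variable {𝒱}

theorem IsCFTType.exists_smul_vacuum (h𝒱 : 𝒱.IsCFTType) {v : V} (hv : v ∈ 𝒱.grade 0) :
    ∃ c : ℂ, v = c • 𝒱.vacuum := by
  obtain ⟨⟨hnt, -⟩, -, hf⟩ := h𝒱
  have hvac : 𝒱.vacuum ≠ 0 := by
    intro h
    obtain ⟨x, hx⟩ := exists_ne (0 : V)
    apply hx
    rw [← 𝒱.creation x, h, map_zero]
  obtain ⟨c, hc⟩ := (finrank_eq_one_iff_of_nonzero' (⟨𝒱.vacuum, 𝒱.vacuum_mem⟩ : 𝒱.grade 0)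
    (by simpa [Subtype.ext_iff] using hvac)).mp hf ⟨v, hv⟩
  exact ⟨c, by simpa using (congrArg Subtype.val hc).symm⟩

/-- Modulo `(L(0) + L(-1)) V`, every vector is the sum of a vector of weight `0` and a vector of
any sufficiently large weight. -/
theorem IsCFTType.exists_sub_mem (h𝒱 : 𝒱.IsCFTType) (v : V) :
    ∃ N : ℕ, ∀ n : ℕ, N ≤ n →
      ∃ c ∈ 𝒱.grade 0, ∃ w ∈ 𝒱.grade n, v - (c + w) ∈ 𝒱.translationSpace := by
  refine 𝒱.induction_grade v (fun k x hx => ?_) (fun x y hx hy => ?_)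
  · rcases lt_trichotomy k 0 with hk | rfl | hk
    · rw [h𝒱.2.1 k hk, Submodule.mem_bot] at hx
      exact ⟨0, fun n _ => ⟨0, zero_mem _, 0, zero_mem _, by simp [hx]⟩⟩
    · exact ⟨0, fun n _ => ⟨x, hx, 0, zero_mem _, by simp⟩⟩
    · lift k to ℕ using hk.le
      refine ⟨k, fun n hn => ?_⟩
      induction n, hn using Nat.le_induction with
      | base => exact ⟨0, zero_mem _, x, hx, by simp⟩
      | succ n hn ih =>
        obtain ⟨c, hc, w, hw, h⟩ := ih
        have hn0 : (n : ℂ) ≠ 0 := by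
          have : n ≠ 0 := by omega
          exact_mod_cast this
        -- Since `n w + L(-1) w ∈ T`, the weight can be raised by one as long as `n ≠ 0`.
        refine ⟨c, hc, -(n : ℂ)⁻¹ • mode 𝒱.Y 𝒱.conformal 0 w, ?_, ?_⟩
        · exact Submodule.smul_mem _ _ (by simpa using 𝒱.conformal_zero_mem_grade hw)
        · have h' := add_mem h ((𝒱.translationSpace).smul_mem (n : ℂ)⁻¹
            (𝒱.smul_add_conformal_zero_mem hw))
          convert h' using 1
          rw [smul_add, smul_smul, Int.cast_natCast, inv_mul_cancel₀ hn0]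
          module
  · obtain ⟨N₁, h₁⟩ := hx
    obtain ⟨N₂, h₂⟩ := hy
    refine ⟨max N₁ N₂, fun n hn => ?_⟩
    obtain ⟨c₁, hc₁, w₁, hw₁, h₁⟩ := h₁ n (le_of_max_le_left hn)
    obtain ⟨c₂, hc₂, w₂, hw₂, h₂⟩ := h₂ n (le_of_max_le_right hn)
    refine ⟨c₁ + c₂, add_mem hc₁ hc₂, w₁ + w₂, add_mem hw₁ hw₂, ?_⟩
    convert add_mem h₁ h₂ using 1
    abel

/-- Skew symmetry for `ω₁ w`. -/
theorem conformal_one_eq_finsum (w : V) :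
    mode 𝒱.Y 𝒱.conformal 1 w
      = ∑ᶠ i : ℕ, (Ring.choose (-1 : ℤ) i : ℤ) •
          mode 𝒱.Y (mode 𝒱.Y w (1 + i) 𝒱.conformal) (-1 - i) 𝒱.vacuum := by
  -- On the left, creation kills every term except `ω₁ w₋₁ 𝟏 = ω₁ w`.
  have h := 𝒱.jacobi w 𝒱.conformal 𝒱.vacuum (-1) 0 1
  rw [finsum_eq_sum_of_support_subset (s := Finset.range 2)] at h
  · simpa [Finset.sum_range_succ, 𝒱.creation, 𝒱.creation_regular] using h
  · intro i hi
    by_contra hne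
    apply hi
    have h : 1 < i := by simpa using hne
    have := Ring.choose_natCast (R := ℤ) 1 i
    simp only [Nat.cast_one, Nat.choose_eq_zero_of_lt h] at this
    simp [this]

/-- A vector `w` of weight `N + 1` such that `w₀, …, w_N` annihilate `ω` lies in
`V₁ + (L(0) + L(-1)) V`. -/
theorem IsCFTType.exists_weight_one_sub_mem (h𝒱 : 𝒱.IsCFTType) {N : ℕ} {w : V}
    (hw : w ∈ 𝒱.grade (N + 1 : ℕ))
    (h0 : ∀ i : ℕ, i < N + 1 → mode 𝒱.Y w i 𝒱.conformal = 0) :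
    ∃ x ∈ 𝒱.grade 1, w - x ∈ 𝒱.translationSpace := by
  set x := mode 𝒱.Y w (1 + N) 𝒱.conformal with hxdef
  have hx : x ∈ 𝒱.grade 1 := 𝒱.mode_mem_grade hw 𝒱.conformal_mem (by push_cast; ring)
  have hsum := 𝒱.conformal_one_eq_finsum w
  -- Terms below `N` vanish by `h0`; at `N + 1` a multiple of the vacuum is taken at a mode other
  -- than `-1`; beyond that the weight is negative.
  rw [finsum_eq_single _ N, 𝒱.L_zero_eq _ w hw] at hsum
  · have hN : ((N : ℂ) + 1) ≠ 0 := Nat.cast_add_one_ne_zero N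
    rw [← hxdef] at hsum
    set e : ℤ := Ring.choose (-1 : ℤ) N
    refine ⟨(((N : ℂ) + 1)⁻¹ * e * (-1) ^ N) • x, Submodule.smul_mem _ _ hx, ?_⟩
    have h := (𝒱.translationSpace).smul_mem (((N : ℂ) + 1)⁻¹ * e) (𝒱.mode_vacuum_sub_mem hx N)
    convert h using 1
    rw [smul_sub, mul_smul _ (e : ℂ) (mode _ _ _ _), Int.cast_smul_eq_zsmul, ← hsum, smul_smul,
      smul_smul]
    push_cast
    rw [inv_mul_cancel₀ hN, one_smul]
  · intro i hi
    rcases lt_or_gt_of_ne hi with hi | hi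
    · have := h0 (1 + i) (by omega)
      push_cast at this
      rw [this, mode_zero]
      simp
    · have hmem : mode 𝒱.Y w (1 + i) 𝒱.conformal ∈ 𝒱.grade (N + 1 - i) :=
        𝒱.mode_mem_grade hw 𝒱.conformal_mem (by push_cast; ring)
      by_cases hi' : i = N + 1
      · subst hi'
        obtain ⟨c, hc⟩ := h𝒱.exists_smul_vacuum (v := mode 𝒱.Y w (1 + (N + 1 : ℕ)) 𝒱.conformal)
          (by simpa using hmem)
        rw [hc, mode_smul, 𝒱.vacuum_mode, if_neg (by omega)]
        simp
      · rw [h𝒱.2.1 _ (by omega), Submodule.mem_bot] at hmem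
        rw [hmem, mode_zero]
        simp

end VertexOperatorAlgebra

/-! ### Faithfulness and vectors with scalar zero mode -/

namespace WeakModule

variable {V M : Type*} [AddCommGroup V] [Module ℂ V] {𝒱 : VertexOperatorAlgebra V}
  [AddCommGroup M] [Module ℂ M] (W : WeakModule 𝒱 M)

theorem zeroMode_conformal_zero {n : ℤ} {v : V} (hv : v ∈ 𝒱.grade n) :
    W.zeroMode (mode 𝒱.Y 𝒱.conformal 0 v) = (-(n : ℂ)) • W.zeroMode v := by
  rw [W.zeroMode_of_mem (𝒱.conformal_zero_mem_grade hv), W.zeroMode_of_mem hv,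
    mode_conformal_zero, add_sub_cancel_right]

/-- On `Vₙ`, `L(0)` contributes `n o(v)` and `L(-1)` contributes `-n o(v)`. -/
theorem translationSpace_le_radical : 𝒱.translationSpace ≤ W.radical := by
  rintro _ ⟨v, rfl⟩
  refine 𝒱.induction_grade v (fun n x hx => ?_) (fun x y hx hy => ?_)
  · simp [radical, VertexOperatorAlgebra.L, 𝒱.L_zero_eq n x hx, W.zeroMode_conformal_zero hx]
  · rw [map_add]
    exact add_mem hx hy

theorem zeroMode_vacuum : W.zeroMode 𝒱.vacuum = 1 := by
  simp [W.zeroMode_of_mem 𝒱.vacuum_mem, W.vacuum_mode]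

/-- A simple vertex operator algebra acts faithfully on a nonzero weak module. -/
theorem eq_zero_of_mode_eq_zero [Nontrivial M] (hs : 𝒱.IsSimple) {v : V}
    (hv : ∀ n, mode W.Y v n = 0) : v = 0 := by
  -- The annihilator of `M` is an ideal, proper because the vacuum acts as the identity.
  let I : Submodule ℂ V := ⨅ n, LinearMap.ker (W.modeLinear n)
  have hI : ∀ x, x ∈ I ↔ ∀ n, mode W.Y x n = 0 := fun x => by
    simp only [I, Submodule.mem_iInf, LinearMap.mem_ker]
    rfl
  have hvac : 𝒱.vacuum ∉ I := fun h => by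
    have := (hI _).mp h (-1)
    rw [W.vacuum_mode, if_pos rfl] at this
    exact one_ne_zero this
  rcases hs.2 I fun a n w hw =>
    (hI _).mpr (W.mode_mode_eq_zero ((hI w).mp hw) a n) with h | h
  · simpa [h] using (hI v).mpr hv
  · exact absurd (h ▸ Submodule.mem_top) hvac

/-- Linear independence of the shifted vertex operators of vectors of distinct weights. -/
theorem eq_zero_of_sum_mode_eq_zero [Nontrivial M] (hs : 𝒱.IsSimple) (d : ℤ) (s : Finset ℕ)
    (u : ℕ → V) (hu : ∀ i ∈ s, u i ∈ 𝒱.grade (d - i))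
    (h : ∀ m : ℤ, ∑ i ∈ s, mode W.Y (u i) (m - i) = 0) : ∀ i ∈ s, u i = 0 := by
  induction s using Finset.induction_on generalizing u with
  | empty => simp
  | insert j s hj ih =>
    -- Applying `L(0)` to every `u i` preserves the relation, since `mode_mode_one` expresses the
    -- modes of `ω₁ u` linearly through those of `u`.
    have hL : ∀ m : ℤ, ∑ i ∈ insert j s,
        mode W.Y (((d : ℂ) - i) • u i) (m - i) = 0 := by
      intro m
      ext w
      have hrw : ∀ i ∈ insert j s, mode W.Y (((d : ℂ) - i) • u i) (m - i) w
          = mode W.Y 𝒱.conformal 1 (mode W.Y (u i) (m - i) w)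
            + mode W.Y (u i) (m + 1 - i) (mode W.Y 𝒱.conformal 0 w)
            - mode W.Y 𝒱.conformal 0 (mode W.Y (u i) (m + 1 - i) w)
            - mode W.Y (u i) (m - i) (mode W.Y 𝒱.conformal 1 w) := fun i hi => by
        have := 𝒱.L_zero_eq _ _ (hu i hi)
        push_cast at this
        rw [← this, mode_mode_one, show m - (i : ℤ) + 1 = m + 1 - i by ring]
      have h' : ∀ (m : ℤ) (w : M), ∑ i ∈ insert j s, mode W.Y (u i) (m - i) w = 0 :=
        fun m w => by simpa using congrArg (fun f => f w) (h m)
      rw [LinearMap.sum_apply, Finset.sum_congr rfl hrw]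
      simp only [Finset.sum_add_distrib, Finset.sum_sub_distrib, ← map_sum, h', map_zero]
      simp
    have hs0 : ∀ i ∈ s, u i = 0 := by
      intro i hi
      -- Subtracting `d - j` times the original relation removes `u j` and leaves the factors `(d -
      -- i) - (d - j) = j - i`.
      have := ih (fun i => ((j : ℂ) - i) • u i)
        (fun i hi => Submodule.smul_mem _ _ (hu i (Finset.mem_insert_of_mem hi)))
        (fun m => by
          have h₁ := hL m
          have h₂ := h m
          rw [Finset.sum_insert hj] at h₁ h₂
          have h₃ : mode W.Y (u j) (m - j) = -∑ i ∈ s, mode W.Y (u i) (m - i) :=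
            eq_neg_of_add_eq_zero_left h₂
          rw [mode_smul, h₃, smul_neg, neg_add_eq_zero, Finset.smul_sum] at h₁
          rw [← sub_eq_zero.mpr h₁.symm, ← Finset.sum_sub_distrib]
          refine Finset.sum_congr rfl fun i _ => ?_
          simp only [mode_smul]
          module) i hi
      have hne : (j : ℂ) - i ≠ 0 := by
        rw [sub_ne_zero]
        intro hji
        exact hj ((Nat.cast_injective hji) ▸ hi)
      exact (smul_eq_zero.mp this).resolve_left hne
    have hj0 : u j = 0 := W.eq_zero_of_mode_eq_zero hs fun n => by
      have := h (n + j)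
      rw [Finset.sum_insert hj, Finset.sum_eq_zero fun i hi => by rw [hs0 i hi, mode_zero]] at this
      simpa using this
    intro i hi
    rcases Finset.mem_insert.mp hi with rfl | hi
    exacts [hj0, hs0 i hi]

/-- If `o(w)` is a scalar on `M` for `w` of weight `N + 1`, then `w₀, …, w_N` vanish on `V`. -/
theorem mode_eq_zero_of_zeroMode_eq_smul [Nontrivial M] (hs : 𝒱.IsSimple) {N : ℕ} {w : V}
    (hw : w ∈ 𝒱.grade (N + 1 : ℕ)) {c : ℂ} (hc : W.zeroMode w = c • 1) {i : ℕ} (hi : i < N + 1) :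
    mode 𝒱.Y w i = 0 := by
  ext a
  refine 𝒱.induction_grade a (fun k a ha => ?_) (fun x y hx hy => by
    rw [map_add, hx, hy, map_add])
  have hzero : mode W.Y w N = c • 1 := by
    rw [← hc, W.zeroMode_of_mem hw]
    push_cast
    rw [add_sub_cancel_right]
  -- `wᵢ a` has weight `N + k - i`, and the scalar `w_N` commutes with every mode of `a`.
  have key := W.eq_zero_of_sum_mode_eq_zero hs (N + k) (Finset.range (N + 1))
    (fun i => (N.choose i : ℤ) • mode 𝒱.Y w i a)
    (fun i _ => Submodule.smul_of_tower_mem _ _ (𝒱.mode_mem_grade hw ha (by push_cast; ring)))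
    (fun m => by
      ext x
      have h := W.mode_commutator w a N (m - N) x
      simp only [hzero] at h
      simp only [← Int.cast_smul_eq_zsmul ℂ, mode_smul] at h ⊢
      simpa using h.symm) i (by simpa using hi)
  have hne : N.choose i ≠ 0 := (Nat.choose_pos (by omega)).ne'
  simp only [← Int.cast_smul_eq_zsmul ℂ, smul_eq_zero] at key
  simpa [hne] using key

end WeakModule

theorem theorem3p4 {V : Type*} [AddCommGroup V] [Module ℂ V]
    (𝒱 : VertexOperatorAlgebra V) (h𝒱 : 𝒱.IsCFTType)
    {M : Type*} [AddCommGroup M] [Module ℂ M] [Nontrivial M]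
    (W : AdmissibleModule 𝒱 M) :
    W.radical = LinearMap.range (𝒱.L 0 + 𝒱.L (-1)) ⊔ W.radical01 ∧
      ∀ a₀ ∈ 𝒱.grade 0, ∀ a₁ ∈ 𝒱.grade 1,
        a₀ + a₁ ∈ W.radical01 → a₁ ∈ 𝒱.adjoint.radical := by
  have hscalar : ∀ c ∈ 𝒱.grade 0, ∀ w, c + w ∈ W.radical → ∃ r : ℂ, W.zeroMode w = r • 1 := by
    intro c hc w h
    obtain ⟨r, rfl⟩ := h𝒱.exists_smul_vacuum hc
    have h' : W.zeroMode (r • 𝒱.vacuum + w) = 0 := h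
    rw [map_add, map_smul, W.zeroMode_vacuum] at h'
    exact ⟨-r, by rw [neg_smul]; exact eq_neg_of_add_eq_zero_right h'⟩
  refine ⟨le_antisymm (fun v hv => ?_)
    (sup_le W.translationSpace_le_radical inf_le_right), fun a₀ h₀ a₁ h₁ h => ?_⟩
  · obtain ⟨N, hN⟩ := h𝒱.exists_sub_mem v
    -- `N + 1` rather than `N`, so that the weight is positive.
    obtain ⟨c, hc, w, hw, hvw⟩ := hN (N + 1) (Nat.le_succ N)
    have hcw : c + w ∈ W.radical := by
      simpa using sub_mem hv (W.translationSpace_le_radical hvw)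
    obtain ⟨r, hr⟩ := hscalar c hc w hcw
    obtain ⟨x, hx, hwx⟩ := h𝒱.exists_weight_one_sub_mem hw fun i hi => by
      rw [W.mode_eq_zero_of_zeroMode_eq_smul h𝒱.1 hw hr hi, LinearMap.zero_apply]
    have hT : v - (c + x) ∈ 𝒱.translationSpace := by
      convert add_mem hvw hwx using 1
      abel
    refine Submodule.mem_sup.mpr ⟨v - (c + x), hT, c + x, ⟨Submodule.add_mem_sup hc hx, ?_⟩,
      by abel⟩
    simpa using sub_mem hv (W.translationSpace_le_radical hT)
  · obtain ⟨r, hr⟩ := hscalar a₀ h₀ a₁ h.2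
    have h0 := W.mode_eq_zero_of_zeroMode_eq_smul (N := 0) h𝒱.1 (by simpa using h₁) hr
      Nat.zero_lt_one
    change 𝒱.adjoint.zeroMode a₁ = 0
    rw [𝒱.adjoint.zeroMode_of_mem h₁]
    simpa [VertexOperatorAlgebra.adjoint] using h0

end
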